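/- Let $n,d\ge 1$, let $a_1,\dots,a_n\in\mathbb{R}^d$, let $f_1,\dots,f_n:\mathbb{R}\to\mathbb{R}$ be twice differentiable, and let $$F(x)=\frac1n\sum_{i=1}^n f_i(a_i^Tx),\qquad x\in\mathbb{R}^d.$$ Write $\nabla^2 f_i(x)$ for the Hessian at $x\in\mathbb{R}^d$ of the map $x\mapsto f_i(a_i^Tx)$, and let $\|\cdot\|$ denote the Euclidean norm of vectors and the spectral norm of matrices. Suppose that $K_1,\dots,K_n$ satisfy $\sup_{x\in\mathbb{R}^d}\|\nabla^2 f_i(x)\|\le K_i$ for all $i$, and put $\widehat K=\frac1n\sum_{i=1}^nK_i$. Let $0<\epsilon,\delta<1$, and let $x\in\mathbb{R}^d$ be such that $\sum_{j=1}^n|f_j''(a_j^Tx)|\,\|a_j\|^2\neq 0$. Let $$p_i=\frac{|f_i''(a_i^Tx)|\,\|a_i\|^2}{\sum_{j=1}^n|f_j''(a_j^Tx)|\,\|a_j\|^2},\qquad i=1,\dots,n.$$ Draw a sample $\mathcal S$ of $|\mathcal S|$ indices from $\{1,\dots,n\}$ independently, with replacement, each index being $i$ with probability $p_i$, and form the sub-sampled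 Hessian $$H(x)=\frac{1}{n|\mathcal S|}\sum_{j\in\mathcal S}\frac1{p_j}\nabla^2 f_j(x),$$ where repeated indices are counted with multiplicity. If $$|\mathcal S|\ \ge\ \frac{4\widehat K^2}{\epsilon^2}\log\frac{2d}{\delta},$$ then $$\Pr\big(\|H(x)-\nabla^2F(x)\|\le\epsilon\big)\ \ge\ 1-\delta .$$ -/

import Mathlib

open MeasureTheory ProbabilityTheory

/-- The Hessian of `F` at `x`, as a linear operator: the derivative of the gradient.
Its operator norm is the spectral norm of the Hessian matrix. -/
noncomputable def hessian {d : ℕ} (F : EuclideanSpace ℝ (Fin d) → ℝ)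
    (x : EuclideanSpace ℝ (Fin d)) :
    EuclideanSpace ℝ (Fin d) →L[ℝ] EuclideanSpace ℝ (Fin d) :=
  fderiv ℝ (gradient F) x

/-- The `i`-th summand `x ↦ f_i(a_iᵀ x)` of the objective. -/
noncomputable def component {n d : ℕ} (f : Fin n → ℝ → ℝ)
    (a : Fin n → EuclideanSpace ℝ (Fin d)) (i : Fin n) (x : EuclideanSpace ℝ (Fin d)) : ℝ :=
  f i (inner ℝ (a i) x)

/-- The objective `F(x) = (1/n) ∑ i, f_i(a_iᵀ x)`. -/
noncomputable def objective {n d : ℕ} (f : Fin n → ℝ → ℝ)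
    (a : Fin n → EuclideanSpace ℝ (Fin d)) (x : EuclideanSpace ℝ (Fin d)) : ℝ :=
  (1 / (n : ℝ)) * ∑ i, component f a i x

/-- The unnormalised sampling weight `|f_i''(a_iᵀ x)| ‖a_i‖²`. -/
noncomputable def samplingWeight {n d : ℕ} (f : Fin n → ℝ → ℝ)
    (a : Fin n → EuclideanSpace ℝ (Fin d)) (x : EuclideanSpace ℝ (Fin d)) (i : Fin n) : ℝ :=
  |iteratedDeriv 2 (f i) (inner ℝ (a i) x)| * ‖a i‖ ^ 2

/-- The non-uniform sampling probabilities `p_i`. -/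
noncomputable def samplingProb {n d : ℕ} (f : Fin n → ℝ → ℝ)
    (a : Fin n → EuclideanSpace ℝ (Fin d)) (x : EuclideanSpace ℝ (Fin d)) (i : Fin n) : ℝ :=
  samplingWeight f a x i / ∑ j, samplingWeight f a x j

/-- The sub-sampled Hessian `(1/(n|S|)) ∑_{j ∈ S} (1/p_j) ∇²f_j(x)` for the sample
`S = (s 0, …, s (m-1))` of size `|S| = m`, in which indices may be repeated. -/
noncomputable def subsampledHessian {n d m : ℕ} (f : Fin n → ℝ → ℝ)
    (a : Fin n → EuclideanSpace ℝ (Fin d)) (p : Fin n → ℝ) (s : Fin m → Fin n)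
    (x : EuclideanSpace ℝ (Fin d)) :
    EuclideanSpace ℝ (Fin d) →L[ℝ] EuclideanSpace ℝ (Fin d) :=
  (1 / ((n : ℝ) * (m : ℝ))) • ∑ k, (1 / p (s k)) • hessian (component f a (s k)) x

/-- The average `K̂ = (1/n) ∑ i, K_i`. -/
noncomputable def avgBound {n : ℕ} (K : Fin n → ℝ) : ℝ :=
  (1 / (n : ℝ)) * ∑ i, K i

/-!
The sub-sampled Hessian is the mean of `m` independent draws of `Y i = (1/(n p_i)) ∇²f_i(x)`.
Importance sampling makes `Y` unbiased for `∇²F(x)` and equalises its norms: `‖Y i‖ ≤ κ`, where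
`κ = (1/n) ∑ |f_j''(a_jᵀ x)| ‖a_j‖²` (`norm_scaled_hessian_le`), and `κ` is at most the average of
the bounds `K_i`. Hence the centred draws `X i = Y i - ∇²F(x)` satisfy `‖X i - X j‖ ≤ 2 κ`, and
the theorem follows from a Hoeffding inequality for symmetric operators
(`sum_prod_lt_norm_sum_le`):
`ℙ (‖∑ₖ X (ωₖ)‖ > s) ≤ 2 d exp (-s² / (m R²))` whenever `‖X i - X j‖ ≤ R`.

The Hoeffding inequality is proved by the Laplace transform method with exchangeable pairs, which
needs neither the Golden-Thompson inequality nor Lieb's theorem. Let `S = ∑ₖ X (ωₖ)` and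
`ψ t = 𝔼 tr exp (t S)`, so that `ψ' t = ∑ₖ 𝔼 tr (X (ωₖ) exp (t S))`. Replacing the `k`-th draw by an
independent copy gives `S'`, exchangeable with `S`, and since the draws are centred
`𝔼 tr (X (ωₖ) exp (t S)) = ½ 𝔼 tr ((S - S') (exp (t S) - exp (t S')))`.
The trace mean value inequality
`tr ((A - B) (exp A - exp B)) ≤ ½ tr ((A - B)² (exp A + exp B))`
(`opTrace_sub_mul_exp_sub_exp_le`), which reduces to a scalar inequality in eigenbases of `A` and
`B`, bounds this by `(t R² / 2) ψ t` (`sum_opTrace_mul_exp_le`). Thus `ψ' ≤ (m R² / 2) t ψ`,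
which integrates to `ψ t ≤ d exp (m R² t² / 4)` (`traceMGF_le`), and Markov's inequality for `S` and
`-S` gives the tail bound.
-/

/-! ### The trace exponential of symmetric operators -/

/-- The logarithmic mean of `exp x` and `exp y` is at most their arithmetic mean. -/
lemma sub_mul_exp_sub_exp_le (x y : ℝ) :
    (x - y) * (Real.exp x - Real.exp y) ≤
      1 / 2 * (x - y) ^ 2 * (Real.exp x + Real.exp y) := by
  wlog hxy : y ≤ x generalizing x y
  · linarith [this y x (le_of_not_ge hxy)]
  have hmono : MonotoneOn (fun u : ℝ => u * (Real.exp u + 1) - 2 * (Real.exp u - 1))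
      (Set.Ici 0) := by
    apply monotoneOn_of_deriv_nonneg (convex_Ici 0) (by fun_prop) (by fun_prop)
    intro u _
    have h : HasDerivAt (fun u : ℝ => u * (Real.exp u + 1) - 2 * (Real.exp u - 1))
        (1 * (Real.exp u + 1) + u * Real.exp u - 2 * Real.exp u) u :=
      ((hasDerivAt_id u).mul ((Real.hasDerivAt_exp u).add_const 1)).sub
        (((Real.hasDerivAt_exp u).sub_const 1).const_mul 2)
    rw [h.deriv]
    have h1 := Real.add_one_le_exp (-u)
    have h2 : Real.exp (-u) * Real.exp u = 1 := by rw [← Real.exp_add]; simp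
    nlinarith [Real.exp_pos u]
  have hu : 0 ≤ x - y := sub_nonneg.2 hxy
  have h0 := hmono (Set.mem_Ici.2 le_rfl) (Set.mem_Ici.2 hu) hu
  have hx : Real.exp x = Real.exp (x - y) * Real.exp y := by rw [← Real.exp_add]; simp
  simp only [Real.exp_zero] at h0
  rw [hx]
  have hpos : 0 ≤ (x - y) * Real.exp y := mul_nonneg hu (Real.exp_pos y).le
  nlinarith [mul_le_mul_of_nonneg_left h0 hpos]

section TraceExp

variable {E : Type*} [NormedAddCommGroup E] [InnerProductSpace ℝ E] [FiniteDimensional ℝ E]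

/-- The trace as a continuous linear functional on the operators of a finite-dimensional
inner product space. -/
noncomputable def opTrace : (E →L[ℝ] E) →L[ℝ] ℝ :=
  LinearMap.toContinuousLinearMap ((LinearMap.trace ℝ E) ∘ₗ (ContinuousLinearMap.coeLM ℝ))

lemma opTrace_eq_sum_inner {ι : Type*} [Fintype ι] (u : OrthonormalBasis ι ℝ E)
    (T : E →L[ℝ] E) : opTrace T = ∑ i, inner ℝ (u i) (T (u i)) :=
  LinearMap.trace_eq_sum_inner (T : E →ₗ[ℝ] E) u

lemma exists_orthonormalBasis_eigenvectors {T : E →L[ℝ] E}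
    (hT : (T : E →ₗ[ℝ] E).IsSymmetric) :
    ∃ (u : OrthonormalBasis (Fin (Module.finrank ℝ E)) ℝ E)
      (l : Fin (Module.finrank ℝ E) → ℝ), ∀ i, T (u i) = l i • u i :=
  ⟨hT.eigenvectorBasis rfl, hT.eigenvalues rfl, fun i => hT.apply_eigenvectorBasis rfl i⟩

lemma exp_apply_eq_of_apply_eq_smul {T : E →L[ℝ] E} {v : E} {l : ℝ} (h : T v = l • v) :
    NormedSpace.exp T v = Real.exp l • v := by
  have hpow : ∀ k : ℕ, (T ^ k) v = l ^ k • v := by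
    intro k
    induction k with
    | zero => simp
    | succ k ih => rw [pow_succ', mul_apply_eq_comp, ih, map_smul, h, smul_smul,
        pow_succ]
  have h1 := (NormedSpace.exp_series_hasSum_exp' (𝕂 := ℝ) T).mapL
    (ContinuousLinearMap.apply ℝ E v)
  have h2 := (NormedSpace.exp_series_hasSum_exp' (𝕂 := ℝ) l).smul_const v
  rw [← Real.exp_eq_exp_ℝ] at h2
  refine h1.unique (h2.congr_fun ?_)
  intro k
  simp [hpow, smul_smul]

/-- The trace of `B * exp T` computed in an orthonormal eigenbasis of `T`. -/
lemma opTrace_mul_exp {ι : Type*} [Fintype ι] {T : E →L[ℝ] E} (u : OrthonormalBasis ι ℝ E)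
    {l : ι → ℝ} (h : ∀ i, T (u i) = l i • u i) (B : E →L[ℝ] E) :
    opTrace (B * NormedSpace.exp T) = ∑ i, Real.exp (l i) * inner ℝ (u i) (B (u i)) := by
  rw [opTrace_eq_sum_inner u]
  refine Finset.sum_congr rfl fun i _ => ?_
  rw [mul_apply_eq_comp, exp_apply_eq_of_apply_eq_smul (h i), map_smul,
    inner_smul_right]

lemma opTrace_exp {ι : Type*} [Fintype ι] {T : E →L[ℝ] E} (u : OrthonormalBasis ι ℝ E)
    {l : ι → ℝ} (h : ∀ i, T (u i) = l i • u i) :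
    opTrace (NormedSpace.exp T) = ∑ i, Real.exp (l i) := by
  simpa using opTrace_mul_exp u h 1

lemma opTrace_exp_nonneg {T : E →L[ℝ] E} (hT : (T : E →ₗ[ℝ] E).IsSymmetric) :
    0 ≤ opTrace (NormedSpace.exp T) := by
  obtain ⟨u, l, h⟩ := exists_orthonormalBasis_eigenvectors hT
  rw [opTrace_exp u h]
  positivity

lemma opTrace_sq_mul_exp_le {T X : E →L[ℝ] E} (hT : (T : E →ₗ[ℝ] E).IsSymmetric)
    (hX : (X : E →ₗ[ℝ] E).IsSymmetric) {R : ℝ} (hR : ‖X‖ ≤ R) :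
    opTrace (X ^ 2 * NormedSpace.exp T) ≤ R ^ 2 * opTrace (NormedSpace.exp T) := by
  obtain ⟨u, l, h⟩ := exists_orthonormalBasis_eigenvectors hT
  rw [opTrace_mul_exp u h, opTrace_exp u h, Finset.mul_sum]
  refine Finset.sum_le_sum fun i _ => ?_
  have h1 : inner ℝ (u i) ((X ^ 2) (u i)) = ‖X (u i)‖ ^ 2 := by
    rw [pow_two, mul_apply_eq_comp, ← real_inner_self_eq_norm_sq]
    exact (hX (u i) (X (u i))).symm
  have h2 : ‖X (u i)‖ ≤ R := by
    simpa using (X.le_opNorm (u i)).trans (mul_le_mul_of_nonneg_right hR (norm_nonneg _))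
  rw [h1, mul_comm]
  gcongr

/-- Trace form of the mean value inequality for the exponential. Expanding both sides over
eigenbases `u` of `A` and `v` of `B` turns it into the scalar inequality for the eigenvalues,
averaged with the weights `⟪u i, v j⟫ ^ 2`. -/
lemma opTrace_sub_mul_exp_sub_exp_le {A B : E →L[ℝ] E}
    (hA : (A : E →ₗ[ℝ] E).IsSymmetric) (hB : (B : E →ₗ[ℝ] E).IsSymmetric) :
    opTrace ((A - B) * (NormedSpace.exp A - NormedSpace.exp B)) ≤
      1 / 2 * (opTrace ((A - B) ^ 2 * NormedSpace.exp A) +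
        opTrace ((A - B) ^ 2 * NormedSpace.exp B)) := by
  obtain ⟨u, l, hu⟩ := exists_orthonormalBasis_eigenvectors hA
  obtain ⟨v, r, hv⟩ := exists_orthonormalBasis_eigenvectors hB
  have hsym : ∀ y z, inner ℝ ((A - B) y) z = inner ℝ y ((A - B) z) := hA.sub hB
  have key : ∀ i j, inner ℝ (v j) ((A - B) (u i)) = (l i - r j) * inner ℝ (v j) (u i) := by
    intro i j
    have hB' : inner ℝ (v j) (B (u i)) = r j * inner ℝ (v j) (u i) := by
      have := hB (v j) (u i)
      simp only [ContinuousLinearMap.coe_coe] at this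
      rw [← this, hv, real_inner_smul_left]
    rw [sub_apply, inner_sub_right, hu, inner_smul_right, hB']
    ring
  have key' : ∀ i j, inner ℝ (u i) ((A - B) (v j)) = (l i - r j) * inner ℝ (v j) (u i) := by
    intro i j
    rw [← hsym, real_inner_comm, key]
  have e1 : ∀ i, inner ℝ (u i) ((A - B) (u i)) =
      ∑ j, (l i - r j) * inner ℝ (v j) (u i) ^ 2 := by
    intro i
    rw [← v.sum_inner_mul_inner]
    refine Finset.sum_congr rfl fun j _ => ?_
    rw [key, real_inner_comm]; ring
  have e2 : ∀ j, inner ℝ (v j) ((A - B) (v j)) =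
      ∑ i, (l i - r j) * inner ℝ (v j) (u i) ^ 2 := by
    intro j
    rw [← u.sum_inner_mul_inner]
    refine Finset.sum_congr rfl fun i _ => ?_
    rw [key']; ring
  have e3 : ∀ i, inner ℝ (u i) (((A - B) ^ 2) (u i)) =
      ∑ j, (l i - r j) ^ 2 * inner ℝ (v j) (u i) ^ 2 := by
    intro i
    rw [pow_two, mul_apply_eq_comp, ← hsym, ← v.sum_inner_mul_inner]
    refine Finset.sum_congr rfl fun j _ => ?_
    rw [real_inner_comm, key]; ring
  have e4 : ∀ j, inner ℝ (v j) (((A - B) ^ 2) (v j)) =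
      ∑ i, (l i - r j) ^ 2 * inner ℝ (v j) (u i) ^ 2 := by
    intro j
    rw [pow_two, mul_apply_eq_comp, ← hsym, ← u.sum_inner_mul_inner]
    refine Finset.sum_congr rfl fun i _ => ?_
    rw [real_inner_comm, key']; ring
  rw [mul_sub, map_sub, opTrace_mul_exp u hu, opTrace_mul_exp v hv, opTrace_mul_exp u hu,
    opTrace_mul_exp v hv]
  simp_rw [e1, e2, e3, e4, Finset.mul_sum]
  rw [Finset.sum_comm (f := fun j i => Real.exp (r j) * ((l i - r j) * _)),
    Finset.sum_comm (f := fun j i => Real.exp (r j) * ((l i - r j) ^ 2 * _)),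
    ← Finset.sum_sub_distrib, ← Finset.sum_add_distrib, Finset.mul_sum]
  refine Finset.sum_le_sum fun i _ => ?_
  rw [← Finset.sum_sub_distrib, ← Finset.sum_add_distrib, Finset.mul_sum]
  refine Finset.sum_le_sum fun j _ => ?_
  linarith [mul_le_mul_of_nonneg_right (sub_mul_exp_sub_exp_le (l i) (r j))
    (sq_nonneg (inner ℝ (v j) (u i)))]

lemma hasDerivAt_opTrace_exp_smul (T : E →L[ℝ] E) (t : ℝ) :
    HasDerivAt (fun t : ℝ => opTrace (NormedSpace.exp (t • T)))
      (opTrace (T * NormedSpace.exp (t • T))) t :=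
  (opTrace (E := E)).hasFDerivAt.comp_hasDerivAt t (hasDerivAt_exp_smul_const' T t)

/-- If the norm of a symmetric operator exceeds `s`, then so does the modulus of one of its
eigenvalues, which contributes to one of the two trace exponentials. -/
lemma exp_le_opTrace_exp_add_of_lt_norm {T : E →L[ℝ] E}
    (hT : (T : E →ₗ[ℝ] E).IsSymmetric) {s t : ℝ} (ht : 0 ≤ t) (hs : 0 ≤ s) (h : s < ‖T‖) :
    Real.exp (t * s) ≤
      opTrace (NormedSpace.exp (t • T)) + opTrace (NormedSpace.exp (t • -T)) := by
  obtain ⟨u, l, hu⟩ := exists_orthonormalBasis_eigenvectors hT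
  obtain ⟨i, hi⟩ : ∃ i, s < |l i| := by
    by_contra! hl
    refine h.not_ge (T.opNorm_le_bound hs fun v => ?_)
    refine le_of_sq_le_sq ?_ (by positivity)
    rw [← u.sum_sq_norm_inner_right (T v), mul_pow, ← u.sum_sq_norm_inner_right v,
      Finset.mul_sum]
    refine Finset.sum_le_sum fun i _ => ?_
    have h1 : inner ℝ (u i) (T v) = l i * inner ℝ (u i) v := by
      have := hT (u i) v
      simp only [ContinuousLinearMap.coe_coe] at this
      rw [← this, hu, real_inner_smul_left]
    rw [h1, norm_mul, mul_pow, Real.norm_eq_abs]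
    gcongr
    exact hl i
  have h1 : opTrace (NormedSpace.exp (t • T)) = ∑ i, Real.exp (t * l i) :=
    opTrace_exp u fun i => by simp [hu, smul_smul]
  have h2 : opTrace (NormedSpace.exp (t • -T)) = ∑ i, Real.exp (-(t * l i)) :=
    opTrace_exp u fun i => by simp [hu, smul_smul]
  rw [h1, h2, ← Finset.sum_add_distrib]
  refine le_trans ?_ (Finset.single_le_sum
    (f := fun i => Real.exp (t * l i) + Real.exp (-(t * l i)))
    (fun j _ => by positivity) (Finset.mem_univ i))
  rcases lt_abs.1 hi with h | h
  · have := Real.exp_le_exp.2 (mul_le_mul_of_nonneg_left h.le ht)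
    linarith [Real.exp_pos (-(t * l i))]
  · have := Real.exp_le_exp.2 (mul_le_mul_of_nonneg_left h.le ht)
    rw [mul_neg] at this
    linarith [Real.exp_pos (t * l i)]

end TraceExp

/-! ### A Hoeffding inequality for sums of independent symmetric operators -/

section Exchange

variable {ι α : Type*} [Fintype ι] [DecidableEq ι]

/-- Swapping the `k`-th coordinate of a sample with an extra independent draw. -/
def exchangeEquiv (α : Type*) (k : ι) : ((ι → α) × α) ≃ ((ι → α) × α) where
  toFun z := (Function.update z.1 k z.2, z.1 k)
  invFun z := (Function.update z.1 k z.2, z.1 k)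
  left_inv z := by simp
  right_inv z := by simp

lemma prod_exchange {M : Type*} [CommMonoid M] (p : α → M) (k : ι) (z : (ι → α) × α) :
    (∏ i, p ((exchangeEquiv α k z).1 i)) * p (exchangeEquiv α k z).2 =
      (∏ i, p (z.1 i)) * p z.2 := by
  have h : ∀ i ∈ Finset.univ.erase k, p (Function.update z.1 k z.2 i) = p (z.1 i) :=
    fun i hi => by rw [Function.update_of_ne (Finset.ne_of_mem_erase hi)]
  simp only [exchangeEquiv, Equiv.coe_fn_mk]
  rw [← Finset.mul_prod_erase _ _ (Finset.mem_univ k),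
    ← Finset.mul_prod_erase _ (fun i => p (z.1 i)) (Finset.mem_univ k),
    Finset.prod_congr rfl h, Function.update_self]
  exact mul_right_comm _ _ _ |>.trans (by rw [mul_comm (p z.2), mul_right_comm])

/-- The coordinate of an i.i.d. sample and an extra independent draw form an exchangeable
pair. -/
lemma sum_exchange [Fintype α] (p : α → ℝ) (k : ι) (G : (ι → α) × α → ℝ) :
    ∑ z, (∏ i, p (z.1 i)) * p z.2 * G (exchangeEquiv α k z) =
      ∑ z, (∏ i, p (z.1 i)) * p z.2 * G z := by
  rw [← Equiv.sum_comp (exchangeEquiv α k) (fun z => (∏ i, p (z.1 i)) * p z.2 * G z)]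
  simp_rw [prod_exchange]

lemma sub_exchange {M : Type*} [AddCommGroup M] (X : α → M) (k : ι) (z : (ι → α) × α) :
    ∑ i, X (z.1 i) - ∑ i, X ((exchangeEquiv α k z).1 i) = X (z.1 k) - X z.2 := by
  have h : ∀ i ∈ Finset.univ.erase k, X (Function.update z.1 k z.2 i) = X (z.1 i) :=
    fun i hi => by rw [Function.update_of_ne (Finset.ne_of_mem_erase hi)]
  simp only [exchangeEquiv, Equiv.coe_fn_mk]
  rw [← Finset.add_sum_erase _ _ (Finset.mem_univ k),
    ← Finset.add_sum_erase _ (fun i => X (Function.update z.1 k z.2 i)) (Finset.mem_univ k),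
    Finset.sum_congr rfl h, Function.update_self]
  abel

lemma sum_prod_eq_one [Fintype α] {p : α → ℝ} (hp1 : ∑ a, p a = 1) :
    ∑ ω : ι → α, ∏ i, p (ω i) = 1 := by
  rw [← Fintype.piFinset_univ, ← Finset.prod_univ_sum]
  simp [hp1]

end Exchange

section Hoeffding

variable {E : Type*} [NormedAddCommGroup E] [InnerProductSpace ℝ E]

lemma isSymmetric_sum {κ : Type*} {s : Finset κ} {X : κ → E →L[ℝ] E}
    (hX : ∀ a ∈ s, (X a : E →ₗ[ℝ] E).IsSymmetric) :
    ((∑ a ∈ s, X a : E →L[ℝ] E) : E →ₗ[ℝ] E).IsSymmetric := by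
  intro y z
  simp only [ContinuousLinearMap.coe_coe, sum_apply, sum_inner, inner_sum]
  exact Finset.sum_congr rfl fun a ha => hX a ha y z

lemma isSymmetric_smul {T : E →L[ℝ] E} (hT : (T : E →ₗ[ℝ] E).IsSymmetric) (t : ℝ) :
    ((t • T : E →L[ℝ] E) : E →ₗ[ℝ] E).IsSymmetric := by
  intro y z
  have := hT y z
  simp only [ContinuousLinearMap.coe_coe] at this
  simp [real_inner_smul_left, real_inner_smul_right, this]

variable [FiniteDimensional ℝ E] {ι α : Type*} [Fintype ι] [DecidableEq ι] [Fintype α]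

/-- The expected trace exponential `𝔼 tr exp (t ∑ₖ X (ωₖ))` of a sum of independent draws from
the weights `p`. -/
noncomputable def traceMGF (ι : Type*) [Fintype ι] [DecidableEq ι] (p : α → ℝ) (X : α → E →L[ℝ] E)
    (t : ℝ) : ℝ :=
  ∑ ω : ι → α, (∏ i, p (ω i)) * opTrace (NormedSpace.exp (t • ∑ i, X (ω i)))

/-- The contribution of one summand to the derivative of the trace moment generating function.
Symmetrising over the exchangeable pair replaces `X (ωₖ) exp (t S)` by half of
`(X (ωₖ) - X a) (exp (t S) - exp (t S'))`, where `S - S' = X (ωₖ) - X a`, and the trace mean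
value inequality applies. -/
lemma sum_opTrace_mul_exp_le {p : α → ℝ} (hp : ∀ a, 0 ≤ p a)
    (hp1 : ∑ a, p a = 1)
    {X : α → E →L[ℝ] E} (hX : ∀ a, (X a : E →ₗ[ℝ] E).IsSymmetric) (hmean : ∑ a, p a • X a = 0)
    {R : ℝ} (hR : ∀ a b, ‖X a - X b‖ ≤ R) {t : ℝ} (ht : 0 < t) (k : ι) :
    ∑ ω : ι → α, (∏ i, p (ω i)) *
        opTrace (X (ω k) * NormedSpace.exp (t • ∑ i, X (ω i))) ≤
      t * R ^ 2 / 2 *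
        ∑ ω : ι → α, (∏ i, p (ω i)) * opTrace (NormedSpace.exp (t • ∑ i, X (ω i))) := by
  set e : (ι → α) → E →L[ℝ] E := fun ω => NormedSpace.exp (t • ∑ i, X (ω i)) with he
  set w : (ι → α) × α → ℝ := fun z => (∏ i, p (z.1 i)) * p z.2 with hw
  set D : (ι → α) × α → E →L[ℝ] E := fun z => X (z.1 k) - X z.2 with hD
  set σ := exchangeEquiv α k
  have hw0 : ∀ z, 0 ≤ w z := fun z => mul_nonneg (Finset.prod_nonneg fun i _ => hp _) (hp _)
  have hS : ∀ ω : ι → α, ((t • ∑ i, X (ω i) : E →L[ℝ] E) : E →ₗ[ℝ] E).IsSymmetric :=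
    fun ω => isSymmetric_smul (isSymmetric_sum fun i _ => hX _) t
  have hmarg : ∀ g : (ι → α) → ℝ, ∑ z, w z * g z.1 = ∑ ω, (∏ i, p (ω i)) * g ω := by
    intro g
    rw [Fintype.sum_prod_type]
    refine Finset.sum_congr rfl fun ω _ => ?_
    simp only [hw]
    rw [← Finset.sum_mul, ← Finset.mul_sum, hp1, mul_one]
  have hzero : ∑ z, w z * opTrace (X z.2 * e z.1) = 0 := by
    rw [Fintype.sum_prod_type]
    refine Finset.sum_eq_zero fun ω _ => ?_
    have : ∑ a, p a * opTrace (X a * e ω) = 0 := by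
      have h := congrArg (fun T => opTrace (T * e ω)) hmean
      simpa [Finset.sum_mul] using h
    simp only [hw, mul_assoc]
    rw [← Finset.mul_sum, this, mul_zero]
  have h1 : ∑ ω : ι → α, (∏ i, p (ω i)) * opTrace (X (ω k) * e ω) =
      ∑ z, w z * opTrace (D z * e z.1) := by
    rw [← hmarg fun ω => opTrace (X (ω k) * e ω)]
    simp only [hD, sub_mul, map_sub, mul_sub, Finset.sum_sub_distrib, hzero, sub_zero]
  have hDσ : ∀ z, D (σ z) = -D z := by
    intro z
    simp [hD, σ, exchangeEquiv]
  have h2 : ∑ z, w z * opTrace (D z * e z.1) = -∑ z, w z * opTrace (D z * e (σ z).1) := by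
    rw [← sum_exchange p k fun z => opTrace (D z * e z.1), ← Finset.sum_neg_distrib]
    refine Finset.sum_congr rfl fun z _ => ?_
    change w z * opTrace (D (σ z) * e (σ z).1) = _
    rw [hDσ, neg_mul, map_neg, mul_neg]
  have h3 : ∑ z, w z * opTrace (D z ^ 2 * e (σ z).1) = ∑ z, w z * opTrace (D z ^ 2 * e z.1) := by
    rw [← sum_exchange p k fun z => opTrace (D z ^ 2 * e z.1)]
    refine Finset.sum_congr rfl fun z _ => ?_
    change _ = w z * opTrace (D (σ z) ^ 2 * e (σ z).1)
    rw [hDσ, neg_sq]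
  have hmvt : ∀ z, opTrace (D z * (e z.1 - e (σ z).1)) ≤
      t / 2 * (opTrace (D z ^ 2 * e z.1) + opTrace (D z ^ 2 * e (σ z).1)) := by
    intro z
    have h := opTrace_sub_mul_exp_sub_exp_le (hS z.1) (hS (σ z).1)
    rw [← smul_sub, sub_exchange, smul_pow, smul_mul_assoc, smul_mul_assoc, smul_mul_assoc,
      map_smul, map_smul, map_smul] at h
    simp only [smul_eq_mul] at h
    refine le_of_mul_le_mul_left ?_ ht
    linarith
  have h4 : ∑ z, w z * opTrace (D z * (e z.1 - e (σ z).1)) ≤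
      t * ∑ z, w z * opTrace (D z ^ 2 * e z.1) := by
    calc _ ≤ ∑ z, w z * (t / 2 * (opTrace (D z ^ 2 * e z.1) +
          opTrace (D z ^ 2 * e (σ z).1))) :=
          Finset.sum_le_sum fun z _ => mul_le_mul_of_nonneg_left (hmvt z) (hw0 z)
      _ = t / 2 * (∑ z, w z * opTrace (D z ^ 2 * e z.1) +
          ∑ z, w z * opTrace (D z ^ 2 * e (σ z).1)) := by
          rw [← Finset.sum_add_distrib, Finset.mul_sum]
          exact Finset.sum_congr rfl fun z _ => by ring
      _ = _ := by rw [h3]; ring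
  have h5 : ∑ z, w z * opTrace (D z ^ 2 * e z.1) ≤ R ^ 2 * ∑ z, w z * opTrace (e z.1) := by
    rw [Finset.mul_sum]
    refine Finset.sum_le_sum fun z _ => ?_
    have hDs : (D z : E →ₗ[ℝ] E).IsSymmetric := (hX _).sub (hX _)
    have := mul_le_mul_of_nonneg_left (opTrace_sq_mul_exp_le (hS z.1) hDs (hR _ _)) (hw0 z)
    linarith
  simp only [mul_sub, map_sub, Finset.sum_sub_distrib] at h4
  rw [← hmarg fun ω => opTrace (e ω), h1]
  nlinarith [mul_le_mul_of_nonneg_left h5 ht.le]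

/-- Sub-Gaussian bound on the trace moment generating function: by the exchangeable pairs
estimate it satisfies `ψ' ≤ (m R² / 2) t ψ`, where `m` is the number of summands. -/
lemma traceMGF_le {p : α → ℝ} (hp : ∀ a, 0 ≤ p a) (hp1 : ∑ a, p a = 1)
    {X : α → E →L[ℝ] E} (hX : ∀ a, (X a : E →ₗ[ℝ] E).IsSymmetric) (hmean : ∑ a, p a • X a = 0)
    {R : ℝ} (hR : ∀ a b, ‖X a - X b‖ ≤ R) {t : ℝ} (ht : 0 ≤ t) :
    traceMGF ι p X t ≤
      Module.finrank ℝ E * Real.exp (Fintype.card ι * R ^ 2 * t ^ 2 / 4) := by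
  set c : ℝ := Fintype.card ι * R ^ 2 / 4 with hc
  set ψ : ℝ → ℝ := traceMGF ι p X with hψ
  have hψe : ∀ t, ψ t = ∑ ω : ι → α, (∏ i, p (ω i)) *
      opTrace (NormedSpace.exp (t • ∑ i, X (ω i))) := fun _ => rfl
  set ψ' : ℝ → ℝ := fun t => ∑ ω : ι → α, (∏ i, p (ω i)) *
      opTrace ((∑ i, X (ω i)) * NormedSpace.exp (t • ∑ i, X (ω i))) with hψ'
  have hder : ∀ t, HasDerivAt ψ (ψ' t) t := by
    intro t
    rw [funext hψe]
    exact HasDerivAt.fun_sum fun ω _ =>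
      (hasDerivAt_opTrace_exp_smul (∑ i, X (ω i)) t).const_mul _
  have hle : ∀ t, 0 < t → ψ' t ≤ 2 * c * t * ψ t := by
    intro t ht
    have h : ψ' t = ∑ k : ι, ∑ ω : ι → α, (∏ i, p (ω i)) *
        opTrace (X (ω k) * NormedSpace.exp (t • ∑ i, X (ω i))) := by
      rw [Finset.sum_comm]
      simp only [hψ', Finset.sum_mul, map_sum, Finset.mul_sum]
    rw [h]
    refine (Finset.sum_le_sum fun k _ =>
      sum_opTrace_mul_exp_le hp hp1 hX hmean hR ht k).trans ?_
    rw [← hψe, Finset.sum_const, nsmul_eq_mul, Finset.card_univ, hc]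
    exact le_of_eq (by ring)
  have hder' : ∀ t, HasDerivAt (fun t => ψ t * Real.exp (-(c * t ^ 2)))
      (ψ' t * Real.exp (-(c * t ^ 2)) +
        ψ t * (Real.exp (-(c * t ^ 2)) * -(c * (2 * t)))) t := by
    intro t
    have : HasDerivAt (fun t : ℝ => -(c * t ^ 2)) (-(c * (2 * t))) t := by
      simpa using ((hasDerivAt_pow 2 t).const_mul c).fun_neg
    exact (hder t).mul this.exp
  have hanti : AntitoneOn (fun t => ψ t * Real.exp (-(c * t ^ 2))) (Set.Ici 0) := by
    refine antitoneOn_of_deriv_nonpos (convex_Ici 0)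
      (fun t _ => (hder' t).continuousAt.continuousWithinAt)
      (fun t _ => (hder' t).differentiableAt.differentiableWithinAt) fun t ht => ?_
    rw [interior_Ici, Set.mem_Ioi] at ht
    rw [(hder' t).deriv]
    have := mul_le_mul_of_nonneg_right (hle t ht) (Real.exp_pos (-(c * t ^ 2))).le
    linarith
  have h0 : ψ 0 = Module.finrank ℝ E := by
    rw [hψe]
    simp only [zero_smul]
    rw [← Finset.sum_mul, sum_prod_eq_one hp1, one_mul,
      opTrace_exp (stdOrthonormalBasis ℝ E) (l := 0) (by simp)]
    simp
  have h := hanti (Set.mem_Ici.2 le_rfl) (Set.mem_Ici.2 ht) ht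
  simp only [h0] at h
  rw [Real.exp_neg, ← div_eq_mul_inv, div_le_iff₀ (Real.exp_pos _)] at h
  have hexp : c * t ^ 2 = Fintype.card ι * R ^ 2 * t ^ 2 / 4 := by rw [hc]; ring
  simpa [hexp] using h

/-- **Hoeffding inequality for symmetric operators**, for a sample of `card ι` independent draws
from the weights `p` on a finite type. -/
theorem sum_prod_lt_norm_sum_le [Nonempty ι] {p : α → ℝ} (hp : ∀ a, 0 ≤ p a)
    (hp1 : ∑ a, p a = 1)
    {X : α → E →L[ℝ] E} (hX : ∀ a, (X a : E →ₗ[ℝ] E).IsSymmetric) (hmean : ∑ a, p a • X a = 0)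
    {R : ℝ} (hR0 : 0 < R) (hR : ∀ a b, ‖X a - X b‖ ≤ R) {s : ℝ} (hs : 0 ≤ s)
    (bad : Finset (ι → α)) (hbad : ∀ ω ∈ bad, s < ‖∑ i, X (ω i)‖) :
    ∑ ω ∈ bad, ∏ i, p (ω i) ≤
      2 * Module.finrank ℝ E * Real.exp (-(s ^ 2 / (Fintype.card ι * R ^ 2))) := by
  have hcard : (0 : ℝ) < Fintype.card ι := by exact_mod_cast Fintype.card_pos
  -- the minimiser of the exponent `card ι * R ^ 2 * t ^ 2 / 4 - t * s`
  set t : ℝ := 2 * s / (Fintype.card ι * R ^ 2) with ht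
  have ht0 : 0 ≤ t := by positivity
  have hw0 : ∀ ω : ι → α, 0 ≤ ∏ i, p (ω i) := fun ω => Finset.prod_nonneg fun i _ => hp _
  have hsym : ∀ ω : ι → α, ((∑ i, X (ω i) : E →L[ℝ] E) : E →ₗ[ℝ] E).IsSymmetric :=
    fun ω => isSymmetric_sum fun i _ => hX _
  have hneg : ∀ a, ((-X a : E →L[ℝ] E) : E →ₗ[ℝ] E).IsSymmetric := fun a => by
    simpa using isSymmetric_smul (hX a) (-1)
  have hb1 := traceMGF_le (ι := ι) hp hp1 hX hmean hR ht0
  have hb2 := traceMGF_le (ι := ι) (X := fun a => -X a) hp hp1 hneg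
    (by simp [smul_neg, hmean])
    (fun a b => by rw [neg_sub_neg, norm_sub_rev]; exact hR a b) ht0
  have hmarkov : Real.exp (t * s) * ∑ ω ∈ bad, ∏ i, p (ω i) ≤
      traceMGF ι p X t + traceMGF ι p (fun a => -X a) t := by
    have hsum : traceMGF ι p X t + traceMGF ι p (fun a => -X a) t =
        ∑ ω : ι → α, (∏ i, p (ω i)) * (opTrace (NormedSpace.exp (t • ∑ i, X (ω i))) +
          opTrace (NormedSpace.exp (t • -∑ i, X (ω i)))) := by
      simp only [traceMGF, mul_add, Finset.sum_neg_distrib]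
      rw [← Finset.sum_add_distrib]
    rw [hsum, Finset.mul_sum]
    refine (Finset.sum_le_sum fun ω hω => ?_).trans
      (Finset.sum_le_sum_of_subset_of_nonneg (Finset.subset_univ bad) fun ω _ _ => ?_)
    · rw [mul_comm]
      exact mul_le_mul_of_nonneg_left
        (exp_le_opTrace_exp_add_of_lt_norm (hsym ω) ht0 hs (hbad ω hω)) (hw0 ω)
    · have h1 := opTrace_exp_nonneg (isSymmetric_smul (hsym ω) t)
      have h2 := opTrace_exp_nonneg (isSymmetric_smul (hsym ω) (-t))
      rw [neg_smul, ← smul_neg] at h2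
      exact mul_nonneg (hw0 ω) (add_nonneg h1 h2)
  have hexp : Real.exp (-(s ^ 2 / (Fintype.card ι * R ^ 2))) * Real.exp (t * s) =
      Real.exp (Fintype.card ι * R ^ 2 * t ^ 2 / 4) := by
    rw [← Real.exp_add, ht]
    congr 1
    field_simp
    ring
  refine le_of_mul_le_mul_left ?_ (Real.exp_pos (t * s))
  calc _ ≤ _ := hmarkov
    _ ≤ 2 * Module.finrank ℝ E * Real.exp (Fintype.card ι * R ^ 2 * t ^ 2 / 4) := by linarith
    _ = _ := by rw [← hexp]; ring

end Hoeffding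

/-! ### The Hessian of the objective -/

section Hessian

variable {n d : ℕ} {f : Fin n → ℝ → ℝ} {a : Fin n → EuclideanSpace ℝ (Fin d)}

lemma hasGradientAt_component (hf : ∀ i, Differentiable ℝ (f i)) (i : Fin n)
    (x : EuclideanSpace ℝ (Fin d)) :
    HasGradientAt (component f a i) (deriv (f i) (inner ℝ (a i) x) • a i) x := by
  rw [hasGradientAt_iff_hasFDerivAt]
  have h := (hf i (inner ℝ (a i) x)).hasDerivAt.comp_hasFDerivAt x
    (innerSL ℝ (a i)).hasFDerivAt
  refine h.congr_fderiv ?_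
  ext y
  simp

lemma hasFDerivAt_gradient_component (hf : ∀ i, Differentiable ℝ (f i))
    (hf' : ∀ i, Differentiable ℝ (deriv (f i))) (i : Fin n) (x : EuclideanSpace ℝ (Fin d)) :
    HasFDerivAt (gradient (component f a i))
      (iteratedDeriv 2 (f i) (inner ℝ (a i) x) • InnerProductSpace.rankOne ℝ (a i) (a i)) x := by
  rw [gradient_eq fun x => hasGradientAt_component hf i x]
  have h := ((hf' i (inner ℝ (a i) x)).hasDerivAt.comp_hasFDerivAt x
    (innerSL ℝ (a i)).hasFDerivAt).smul_const (a i)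
  refine h.congr_fderiv ?_
  ext1 y
  simp [iteratedDeriv_succ, smul_smul]

/-- The Hessian of `x ↦ f_i(a_iᵀ x)` is `f_i''(a_iᵀ x) a_i a_iᵀ`. -/
lemma hessian_component (hf : ∀ i, Differentiable ℝ (f i))
    (hf' : ∀ i, Differentiable ℝ (deriv (f i))) (i : Fin n) (x : EuclideanSpace ℝ (Fin d)) :
    hessian (component f a i) x =
      iteratedDeriv 2 (f i) (inner ℝ (a i) x) • InnerProductSpace.rankOne ℝ (a i) (a i) :=
  (hasFDerivAt_gradient_component hf hf' i x).fderiv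

lemma isSymmetric_hessian_component (hf : ∀ i, Differentiable ℝ (f i))
    (hf' : ∀ i, Differentiable ℝ (deriv (f i))) (i : Fin n) (x : EuclideanSpace ℝ (Fin d)) :
    (hessian (component f a i) x :
      EuclideanSpace ℝ (Fin d) →ₗ[ℝ] EuclideanSpace ℝ (Fin d)).IsSymmetric := by
  rw [hessian_component hf hf']
  refine isSymmetric_smul (fun y z => ?_) _
  simp [real_inner_smul_right, real_inner_comm, mul_comm]

lemma norm_hessian_component (hf : ∀ i, Differentiable ℝ (f i))
    (hf' : ∀ i, Differentiable ℝ (deriv (f i))) (i : Fin n) (x : EuclideanSpace ℝ (Fin d)) :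
    ‖hessian (component f a i) x‖ = samplingWeight f a x i := by
  rw [hessian_component hf hf', norm_smul, InnerProductSpace.norm_rankOne, samplingWeight,
    Real.norm_eq_abs, pow_two]

lemma hessian_objective (hf : ∀ i, Differentiable ℝ (f i))
    (hf' : ∀ i, Differentiable ℝ (deriv (f i))) (x : EuclideanSpace ℝ (Fin d)) :
    hessian (objective f a) x = (1 / (n : ℝ)) • ∑ i, hessian (component f a i) x := by
  have hgrad : gradient (objective f a) =
      fun y => (1 / (n : ℝ)) • ∑ i, gradient (component f a i) y := by
    refine gradient_eq fun y => ?_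
    rw [hasGradientAt_iff_hasFDerivAt]
    have h : HasFDerivAt (objective f a) _ y := (HasFDerivAt.fun_sum fun i _ =>
      (hasGradientAt_component hf i y).differentiableAt.hasFDerivAt).const_mul (1 / (n : ℝ))
    refine h.congr_fderiv ?_
    simp only [map_smul, map_sum, toDual_gradient]
  rw [hessian, hgrad]
  refine ((HasFDerivAt.fun_sum fun i _ =>
    hasFDerivAt_gradient_component hf hf' i x).const_smul (1 / (n : ℝ))).fderiv.trans ?_
  simp only [hessian_component hf hf']

end Hessian

/-! ### The sampled Hessian -/

section Sampling

variable {n d : ℕ} {f : Fin n → ℝ → ℝ} {a : Fin n → EuclideanSpace ℝ (Fin d)}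
  {x : EuclideanSpace ℝ (Fin d)}

lemma samplingWeight_nonneg (i : Fin n) : 0 ≤ samplingWeight f a x i := by
  unfold samplingWeight; positivity

lemma samplingProb_nonneg (i : Fin n) : 0 ≤ samplingProb f a x i :=
  div_nonneg (samplingWeight_nonneg i) (Finset.sum_nonneg fun j _ => samplingWeight_nonneg j)

lemma sum_samplingProb (hx : ∑ j, samplingWeight f a x j ≠ 0) :
    ∑ i, samplingProb f a x i = 1 := by
  simp only [samplingProb]
  rw [← Finset.sum_div, div_self hx]

/-- Importance sampling equalises the norms: every rescaled summand `(1/(n p_i)) ∇²f_i(x)` has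
norm at most the average sampling weight. -/
lemma norm_scaled_hessian_le (hf : ∀ i, Differentiable ℝ (f i))
    (hf' : ∀ i, Differentiable ℝ (deriv (f i))) (i : Fin n) :
    ‖(1 / (n : ℝ)) • (1 / samplingProb f a x i) • hessian (component f a i) x‖ ≤
      1 / (n : ℝ) * ∑ j, samplingWeight f a x j := by
  have hw := samplingWeight_nonneg (f := f) (a := a) (x := x) i
  have hW : 0 ≤ ∑ j, samplingWeight f a x j := Finset.sum_nonneg fun j _ => samplingWeight_nonneg j
  rw [norm_smul, norm_smul, norm_hessian_component hf hf', Real.norm_of_nonneg (by positivity),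
    Real.norm_of_nonneg (one_div_nonneg.2 (samplingProb_nonneg i))]
  refine mul_le_mul_of_nonneg_left ?_ (by positivity)
  rw [samplingProb, one_div_div, div_mul_eq_mul_div]
  exact div_le_of_le_mul₀ hw hW le_rfl

/-- The rescaled summands `(1/(n p_i)) ∇²f_i(x)` are unbiased. An index of probability zero has
zero Hessian, so the junk value `1 / 0 = 0` is harmless. -/
lemma sum_samplingProb_smul_scaled_hessian (hf : ∀ i, Differentiable ℝ (f i))
    (hf' : ∀ i, Differentiable ℝ (deriv (f i))) (hx : ∑ j, samplingWeight f a x j ≠ 0) :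
    ∑ i, samplingProb f a x i •
      ((1 / (n : ℝ)) • (1 / samplingProb f a x i) • hessian (component f a i) x) =
      hessian (objective f a) x := by
  rw [hessian_objective hf hf', Finset.smul_sum]
  refine Finset.sum_congr rfl fun i _ => ?_
  by_cases hp : samplingProb f a x i = 0
  · have hw : samplingWeight f a x i = 0 := (div_eq_zero_iff.1 hp).resolve_right hx
    have h0 : hessian (component f a i) x = 0 := by
      rw [← norm_eq_zero, norm_hessian_component hf hf', hw]
    ext1 y
    simp [hp, h0]
  · rw [smul_comm, smul_smul (samplingProb f a x i), mul_one_div_cancel hp, one_smul]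

lemma subsampledHessian_sub {m : ℕ} (hm : m ≠ 0) (p : Fin n → ℝ) (s : Fin m → Fin n)
    (T : EuclideanSpace ℝ (Fin d) →L[ℝ] EuclideanSpace ℝ (Fin d)) :
    subsampledHessian f a p s x - T = (1 / (m : ℝ)) •
      ∑ k, ((1 / (n : ℝ)) • (1 / p (s k)) • hessian (component f a (s k)) x - T) := by
  have hm' : (m : ℝ) ≠ 0 := by exact_mod_cast hm
  rw [Finset.sum_sub_distrib, smul_sub, ← Finset.smul_sum, smul_smul, Finset.sum_const,
    Finset.card_univ, Fintype.card_fin, ← Nat.cast_smul_eq_nsmul ℝ, smul_smul,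
    one_div_mul_cancel hm', one_smul, subsampledHessian, one_div_mul_one_div, mul_comm (m : ℝ)]

end Sampling

/-- The law of an i.i.d. sample on a finite type, evaluated on an arbitrary event. -/
lemma measureReal_sample_mem {ι α Ω : Type*} [Fintype ι] [Finite α] [MeasurableSpace α]
    [MeasurableSingletonClass α] [MeasurableSpace Ω] {μ : Measure Ω} [IsProbabilityMeasure μ]
    {S : ι → Ω → α} (hS : ∀ k, Measurable (S k)) (hindep : iIndepFun S μ) {p : α → ℝ}
    (hlaw : ∀ k i, μ.real {ω | S k ω = i} = p i) (B : Finset (ι → α)) :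
    μ.real {ω | (fun k => S k ω) ∈ B} = ∑ σ ∈ B, ∏ k, p (σ k) := by
  have hmeas : Measurable fun ω => fun k => S k ω := measurable_pi_lambda _ hS
  have hU : {ω | (fun k => S k ω) ∈ B} = ⋃ σ ∈ B, {ω | (fun k => S k ω) = σ} := by
    ext ω; simp
  rw [hU, measureReal_biUnion_finset]
  · refine Finset.sum_congr rfl fun σ _ => ?_
    have h := hindep.measure_inter_preimage_eq_mul Finset.univ (sets := fun k => {σ k})
      fun k _ => measurableSet_singleton _
    have hI : {ω | (fun k => S k ω) = σ} = ⋂ k ∈ Finset.univ, S k ⁻¹' {σ k} := by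
      ext ω; simp [funext_iff]
    rw [hI, measureReal_def, h, ENNReal.toReal_prod]
    exact Finset.prod_congr rfl fun k _ => hlaw k (σ k)
  · intro σ _ τ _ hne
    exact Set.disjoint_left.2 fun ω h1 h2 => hne (h1.symm.trans h2)
  · exact fun σ _ => hmeas (measurableSet_singleton σ)

/-! ### Concentration of the sub-sampled Hessian -/

theorem mainTheorem5 {n d m : ℕ}
    (f : Fin n → ℝ → ℝ) (a : Fin n → EuclideanSpace ℝ (Fin d))
    (hf : ∀ i, Differentiable ℝ (f i)) (hf' : ∀ i, Differentiable ℝ (deriv (f i)))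
    (K : Fin n → ℝ) (hK : ∀ i, ∀ y, ‖hessian (component f a i) y‖ ≤ K i)
    (ε δ : ℝ) (hε : 0 < ε) (hε1 : ε < 1) (hδ : 0 < δ) (hδ1 : δ < 1)
    (hm : 4 * avgBound K ^ 2 / ε ^ 2 * Real.log (2 * (d : ℝ) / δ) ≤ (m : ℝ))
    (x : EuclideanSpace ℝ (Fin d))
    (hx : ∑ j, samplingWeight f a x j ≠ 0)
    {Ω : Type*} [MeasurableSpace Ω] (μ : Measure Ω) [IsProbabilityMeasure μ]
    (S : Fin m → Ω → Fin n) (hS : ∀ k, Measurable (S k)) (hindep : iIndepFun S μ)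
    (hlaw : ∀ k i, μ.real {ω | S k ω = i} = samplingProb f a x i) :
    1 - δ ≤ μ.real {ω | ‖subsampledHessian f a (samplingProb f a x) (fun k => S k ω) x
        - hessian (objective f a) x‖ ≤ ε} := by
  classical
  have hW : 0 < ∑ j, samplingWeight f a x j :=
    lt_of_le_of_ne (Finset.sum_nonneg fun j _ => samplingWeight_nonneg j) hx.symm
  have hn : 0 < n := by
    rcases Nat.eq_zero_or_pos n with rfl | h
    · simp at hx
    · exact h
  have hd : 0 < d := by
    rcases Nat.eq_zero_or_pos d with rfl | h
    · exact absurd (Finset.sum_eq_zero fun j _ => by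
        simp [samplingWeight, Subsingleton.elim (a j) 0]) hx
    · exact h
  have hnR : (0 : ℝ) < n := by exact_mod_cast hn
  have hdR : (1 : ℝ) ≤ d := by exact_mod_cast hd
  set κ : ℝ := 1 / (n : ℝ) * ∑ j, samplingWeight f a x j with hκ
  have hκ0 : 0 < κ := by positivity
  have hκK : κ ≤ avgBound K := by
    refine mul_le_mul_of_nonneg_left (Finset.sum_le_sum fun j _ => ?_) (by positivity)
    rw [← norm_hessian_component hf hf']
    exact hK j x
  have hlog : 0 < Real.log (2 * (d : ℝ) / δ) :=
    Real.log_pos ((one_lt_div hδ).2 (by linarith))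
  have hKpos : 0 < avgBound K := hκ0.trans_le hκK
  have hmR : (0 : ℝ) < m := lt_of_lt_of_le (by positivity) hm
  have hm0 : m ≠ 0 := by rintro rfl; simp at hmR
  have : Nonempty (Fin m) := ⟨⟨0, Nat.pos_of_ne_zero hm0⟩⟩
  set p := samplingProb f a x with hp
  set M := hessian (objective f a) x with hM
  set Y : Fin n → EuclideanSpace ℝ (Fin d) →L[ℝ] EuclideanSpace ℝ (Fin d) :=
    fun i => (1 / (n : ℝ)) • (1 / p i) • hessian (component f a i) x with hY
  have hYsym : ∀ i, (Y i : EuclideanSpace ℝ (Fin d) →ₗ[ℝ] _).IsSymmetric := fun i =>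
    isSymmetric_smul (isSymmetric_smul (isSymmetric_hessian_component hf hf' i x) _) _
  have hMsym : (M : EuclideanSpace ℝ (Fin d) →ₗ[ℝ] _).IsSymmetric := by
    rw [hM, hessian_objective hf hf']
    exact isSymmetric_smul (isSymmetric_sum fun i _ => isSymmetric_hessian_component hf hf' i x) _
  have hmean : ∑ i, p i • (Y i - M) = 0 := by
    simp only [smul_sub, Finset.sum_sub_distrib]
    rw [← Finset.sum_smul, sum_samplingProb hx, one_smul,
      sum_samplingProb_smul_scaled_hessian hf hf' hx, sub_self]
  have hR : ∀ i j, ‖(Y i - M) - (Y j - M)‖ ≤ 2 * κ := fun i j => by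
    rw [sub_sub_sub_cancel_right]
    linarith [norm_sub_le (Y i) (Y j), norm_scaled_hessian_le (x := x) (a := a) hf hf' i,
      norm_scaled_hessian_le (x := x) (a := a) hf hf' j]
  set bad : Finset (Fin m → Fin n) :=
    Finset.univ.filter fun σ => ε < ‖subsampledHessian f a p σ x - M‖ with hbad
  have hbadnorm : ∀ σ ∈ bad, m * ε < ‖∑ k, (Y (σ k) - M)‖ := by
    intro σ hσ
    have h := (Finset.mem_filter.1 hσ).2
    rw [subsampledHessian_sub hm0, norm_smul, Real.norm_of_nonneg (by positivity), one_div,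
      ← div_eq_inv_mul, lt_div_iff₀ hmR, mul_comm] at h
    exact h
  have htail := sum_prod_lt_norm_sum_le (p := p) (X := fun i => Y i - M)
    (fun i => samplingProb_nonneg i) (sum_samplingProb hx) (fun i => (hYsym i).sub hMsym) hmean
    (by positivity) hR (by positivity) bad hbadnorm
  rw [finrank_euclideanSpace_fin, Fintype.card_fin] at htail
  -- the sample size makes the exponent at least `log (2 d / δ)`
  have hexp : Real.log (2 * (d : ℝ) / δ) ≤ (m * ε) ^ 2 / (m * (2 * κ) ^ 2) := by
    have h1 : (m * ε) ^ 2 / (m * (2 * κ) ^ 2) = m * ε ^ 2 / (4 * κ ^ 2) := by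
      field_simp
      ring
    have h2 : 4 * κ ^ 2 / ε ^ 2 * Real.log (2 * (d : ℝ) / δ) ≤ m := by
      refine le_trans ?_ hm
      gcongr
    rw [h1, le_div_iff₀ (by positivity)]
    rw [div_mul_eq_mul_div, div_le_iff₀ (by positivity)] at h2
    linarith
  have hδ' : 2 * (d : ℝ) * Real.exp (-((m * ε) ^ 2 / (m * (2 * κ) ^ 2))) ≤ δ := by
    calc _ ≤ 2 * (d : ℝ) * Real.exp (-Real.log (2 * (d : ℝ) / δ)) := by gcongr
      _ = δ := by
        rw [Real.exp_neg, Real.exp_log (by positivity)]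
        field_simp
  have hprob : μ.real {ω | (fun k => S k ω) ∈ bad} ≤ δ := by
    rw [measureReal_sample_mem hS hindep hlaw]
    exact htail.trans hδ'
  have hmeas : MeasurableSet {ω | (fun k => S k ω) ∈ bad} :=
    (measurable_pi_lambda (fun ω k => S k ω) hS) bad.measurableSet
  have hcompl : {ω | ‖subsampledHessian f a p (fun k => S k ω) x - M‖ ≤ ε} =
      {ω | (fun k => S k ω) ∈ bad}ᶜ := by
    ext ω
    simp [hbad]
  rw [hcompl, probReal_compl_eq_one_sub hmeas]
  linarith
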